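/- Let $n\ge 2$, let $D\subset\mathbb R^n$ be a domain (a nonempty connected open set), and let $p\ge 1$. Conventions. A curve is a continuous map $\gamma:\Delta\to\mathbb R^n$ of an interval $\Delta\subset\mathbb R$; it is closed if $\Delta=[a,b]$ is compact (it need not be a loop). For a curve family $\Gamma$, $\operatorname{adm}\Gamma$ is the set of Borel functions $\rho:\mathbb R^n\to[0,\infty]$ with $\int_\gamma\rho\,|dx|\ge 1$ for every locally rectifiable $\gamma\in\Gamma$, and $M_p(\Gamma)=\inf_{\rho\in\operatorname{adm}\Gamma}\int_{\mathbb R^n}\rho^p\,dm$ (equal to $+\infty$ if $\operatorname{adm}\Gamma=\varnothing$), where $m(\cdot)$ denotes Lebesgue measure. A property holds for $p$-almost every curve of a family if the subfamily where it fails has $p$-modulus zero. For a rectifiable $\beta:[a,b]\to\mathbb R^n$ of length $c$ let $l_\beta(t)$ be the length of $\beta|_{[a,t]}$, and let $\beta^0:[0,c]\to\mathbb R^n$ be its normal representation, $\beta=\beta^0\circ l_\beta$. If $\alpha:[a,b]\to D$ is a curve with $\beta=f\circ\alpha$ rectifiable and no fibre of $f$ contains a nondegenerate curve, then the $f$-representation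 of $\alpha$ is the unique map $\alpha^*:[0,c]\to D$ with $\alpha=\alpha^*\circ l_\beta$. Let $f:D\to\mathbb R^n$ be a continuous mapping such that: 1. $f$ is discrete: every $f^{-1}(y)$, $y\in\mathbb R^n$, consists of isolated points; 2. $f$ is differentiable almost everywhere in $D$; 3. $f$ has the $N$-property ($m(f(S))=0$ whenever $S\subset D$, $m(S)=0$) and the $N^{-1}$-property ($m(f^{-1}(S))=0$ whenever $S\subset\mathbb R^n$, $m(S)=0$); 4. $f$ has the $ACP_p^{-1}$-property: for $p$-almost every closed curve $\tilde\gamma$ in $\mathbb R^n$, every lifting $\gamma$ of $\tilde\gamma$ (a curve $\gamma$ in $D$ with $f\circ\gamma=\tilde\gamma$) is rectifiable and its $f$-representation $\gamma^*$ is absolutely continuous. (Nonrectifiable closed curves, which form a family of $p$-modulus zero, are disregarded here.) Let $\Gamma$ be a family of curves in $D$ and $m$ a positive integer such that $f$ winds every $\alpha\in\Gamma$ $m$ times around itself, that is: $\alpha$ is a closed curve, $\beta=f\circ\alpha$ is rectifiable, and, with $c$ the length of $\beta$ and $h=c/m$, one has $\beta^0(t+jh)=\beta^0(t)$ and $\alpha^*(t+jh)\ne\alpha^*(t)$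 whenever $0\le t<t+jh<c$ and $j\in\{1,\dots,m-1\}$. Then for every $\rho\in\operatorname{adm}\Gamma$ $$M_p(f(\Gamma))\le\frac1m\int_D K_{I,p}(x,f)\,\rho^p(x)\,dm(x),$$ where $f(\Gamma)=\{f\circ\alpha:\alpha\in\Gamma\}$ and, with $J(x,f)=\det f'(x)$ and $l(f'(x))=\inf_{|h|=1}|f'(x)h|$, $K_{I,p}(x,f)=|J(x,f)|/l(f'(x))^p$ if $J(x,f)\ne0$, $K_{I,p}(x,f)=1$ if $f'(x)=0$, and $K_{I,p}(x,f)=\infty$ otherwise. -/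

import Mathlib

open MeasureTheory Set
open scoped ENNReal

noncomputable section

/-- Euclidean space `ℝⁿ`. -/
abbrev Eucl (n : ℕ) : Type := EuclideanSpace ℝ (Fin n)

/-- A curve in `ℝⁿ`: a continuous map of an interval `dom ⊆ ℝ` (of any kind) into `ℝⁿ`.
Values of `toFun` outside `dom` are irrelevant. -/
structure Curve (n : ℕ) where
  dom : Set ℝ
  dom_nonempty : dom.Nonempty
  dom_interval : dom.OrdConnected
  toFun : ℝ → Eucl n
  continuousOn : ContinuousOn toFun dom

/-- The curve is rectifiable: it has finite length. -/
def Curve.Rectifiable {n : ℕ} (γ : Curve n) : Prop := BoundedVariationOn γ.toFun γ.dom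

/-- The curve is locally rectifiable: each of its closed subcurves has finite length. -/
def Curve.LocallyRectifiable {n : ℕ} (γ : Curve n) : Prop :=
  LocallyBoundedVariationOn γ.toFun γ.dom

/-- The curve is closed, in the sense that its parameter interval is the compact interval
`[a, b]` (it need not be a loop). -/
def Curve.IsClosedOn {n : ℕ} (γ : Curve n) (a b : ℝ) : Prop := a ≤ b ∧ γ.dom = Icc a b

/-- The curve lies in the set `D`. -/
def Curve.LiesIn {n : ℕ} (γ : Curve n) (D : Set (Eucl n)) : Prop := MapsTo γ.toFun γ.dom D

/-- The length function `l_γ(t) = S(γ, [a, t])` of `γ : [a, b] → ℝⁿ`. -/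
def lengthFun {n : ℕ} (γ : ℝ → Eucl n) (a b t : ℝ) : ℝ := variationOnFromTo γ (Icc a b) a t

/-- The length of a rectifiable `γ : [a, b] → ℝⁿ`. -/
def curveLength {n : ℕ} (γ : ℝ → Eucl n) (a b : ℝ) : ℝ := lengthFun γ a b b

/-- The normal representation `γ⁰ : [0, l(γ)] → ℝⁿ` of a rectifiable `γ : [a, b] → ℝⁿ`,
i.e. the map with `γ t = γ⁰ (l_γ(t))`. -/
def normalRep {n : ℕ} (γ : ℝ → Eucl n) (a b : ℝ) : ℝ → Eucl n :=
  naturalParameterization γ (Icc a b) a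

theorem normalRep_lengthFun {n : ℕ} {γ : ℝ → Eucl n} {a b : ℝ}
    (hγ : BoundedVariationOn γ (Icc a b)) {t : ℝ} (ht : t ∈ Icc a b) :
    normalRep γ a b (lengthFun γ a b t) = γ t :=
  edist_eq_zero.1 (edist_naturalParameterization_eq_zero hγ.locallyBoundedVariationOn
    (left_mem_Icc.2 (ht.1.trans ht.2)) ht)

/-- The integral `∫_γ ρ |dx|` over a locally rectifiable curve: the supremum over all closed
subcurves `γ|[a, b]` of `∫_0^{l(γ|[a, b])} ρ(γ|[a, b]⁰(s)) ds`. -/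
def lineIntegral {n : ℕ} (ρ : Eucl n → ℝ≥0∞) (γ : Curve n) : ℝ≥0∞ :=
  ⨆ (a ∈ γ.dom) (b ∈ γ.dom) (_ : a ≤ b),
    ∫⁻ s in Icc 0 (curveLength γ.toFun a b), ρ (normalRep γ.toFun a b s)

/-- `ρ ∈ adm Γ`: a Borel function `ρ : ℝⁿ → [0, ∞]` with `∫_γ ρ |dx| ≥ 1` for every locally
rectifiable `γ ∈ Γ`. -/
def Admissible {n : ℕ} (Γ : Set (Curve n)) (ρ : Eucl n → ℝ≥0∞) : Prop :=
  Measurable ρ ∧ ∀ γ ∈ Γ, γ.LocallyRectifiable → 1 ≤ lineIntegral ρ γ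

/-- The `p`-modulus `M_p(Γ)`; it is `∞` if no function is admissible. -/
def modulus {n : ℕ} (p : ℝ) (Γ : Set (Curve n)) : ℝ≥0∞ :=
  ⨅ (ρ : Eucl n → ℝ≥0∞) (_ : Admissible Γ ρ), ∫⁻ x, ρ x ^ p

/-- `γ` is a lifting of `β` under `f : D → ℝⁿ`: `γ` is a curve in `D` and `β = f ∘ γ`. -/
def IsLifting {n : ℕ} (D : Set (Eucl n)) (f : Eucl n → Eucl n) (γ β : Curve n) : Prop :=
  γ.LiesIn D ∧ γ.dom = β.dom ∧ ∀ t ∈ β.dom, β.toFun t = f (γ.toFun t)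

/-- The image family `f(Γ) = {f ∘ γ : γ ∈ Γ}` of a family `Γ` of curves in `D`. -/
def imageFamily {n : ℕ} (D : Set (Eucl n)) (f : Eucl n → Eucl n) (Γ : Set (Curve n)) :
    Set (Curve n) :=
  {β | ∃ γ ∈ Γ, IsLifting D f γ β}

/-- `αs : [0, l(β)] → D` is the `f`-representation of `α : [a, b] → D` with respect to the
rectifiable curve `β = f ∘ α`, that is `α = αs ∘ l_β`. Since `l_β` maps `[a, b]` onto
`[0, l(β)]`, `αs` is unique on `[0, l(β)]`; it exists if no fibre of `f` contains a nondegenerate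
curve. -/
def IsFRep {n : ℕ} (f : Eucl n → Eucl n) (α : ℝ → Eucl n) (a b : ℝ) (αs : ℝ → Eucl n) : Prop :=
  ∀ t ∈ Icc a b, α t = αs (lengthFun (f ∘ α) a b t)

/-- `f` winds the closed curve `α` `m` times around itself. -/
def WindsAround {n : ℕ} (f : Eucl n → Eucl n) (m : ℕ) (α : Curve n) : Prop :=
  ∃ a b : ℝ, α.IsClosedOn a b ∧
    BoundedVariationOn (f ∘ α.toFun) (Icc a b) ∧
    ∃ αs : ℝ → Eucl n, IsFRep f α.toFun a b αs ∧
      let c := curveLength (f ∘ α.toFun) a b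
      let h := c / m
      ∀ (t : ℝ) (j : ℕ), 1 ≤ j → j < m → 0 ≤ t → t < t + j * h → t + j * h < c →
        normalRep (f ∘ α.toFun) a b (t + j * h) = normalRep (f ∘ α.toFun) a b t ∧
        αs (t + j * h) ≠ αs t

/-- `f : D → ℝⁿ` is discrete: each fibre consists of isolated points. -/
def DiscreteMapping {n : ℕ} (D : Set (Eucl n)) (f : Eucl n → Eucl n) : Prop :=
  ∀ y, IsDiscrete (D ∩ f ⁻¹' {y})

/-- Luzin's `N`-property of `f : D → ℝⁿ`. -/
def LuzinN {n : ℕ} (D : Set (Eucl n)) (f : Eucl n → Eucl n) : Prop :=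
  ∀ S ⊆ D, volume S = 0 → volume (f '' S) = 0

/-- The `N⁻¹`-property of `f : D → ℝⁿ`. -/
def LuzinNInv {n : ℕ} (D : Set (Eucl n)) (f : Eucl n → Eucl n) : Prop :=
  ∀ S : Set (Eucl n), volume S = 0 → volume (D ∩ f ⁻¹' S) = 0

/-- The `ACP_p⁻¹`-property of `f : D → ℝⁿ`: for `p`-almost every closed curve `β` in `ℝⁿ`, every
lifting `γ` of `β` is rectifiable and its `f`-representation `γ*` is absolutely continuous on
`[0, l(β)]`. (Nonrectifiable closed curves, for which `γ*` makes no sense, form a family of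
modulus zero, so they are left out of the exceptional family.) -/
def ACPInv {n : ℕ} (p : ℝ) (D : Set (Eucl n)) (f : Eucl n → Eucl n) : Prop :=
  modulus p {β : Curve n | ∃ a b : ℝ, β.IsClosedOn a b ∧ β.Rectifiable ∧
    ¬ ∀ γ : Curve n, IsLifting D f γ β →
      γ.Rectifiable ∧
      ∃ γs : ℝ → Eucl n, IsFRep f γ.toFun a b γs ∧
        AbsolutelyContinuousOnInterval γs 0 (curveLength β.toFun a b)} = 0

/-- `l(A) = inf {|A h| : |h| = 1}`. -/
def minStretch {n : ℕ} (A : Eucl n →L[ℝ] Eucl n) : ℝ :=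
  sInf ((fun h => ‖A h‖) '' Metric.sphere (0 : Eucl n) 1)

open Classical in
/-- The inner dilatation `K_{I,p}(x, f)` of order `p`. The Jacobian is nonzero only at points of
differentiability (`n ≥ 1`). -/
def innerDilatation {n : ℕ} (p : ℝ) (f : Eucl n → Eucl n) (x : Eucl n) : ℝ≥0∞ :=
  if (fderiv ℝ f x).det ≠ 0 then
    ENNReal.ofReal (|(fderiv ℝ f x).det| / minStretch (fderiv ℝ f x) ^ p)
  else if HasFDerivAt f (0 : Eucl n →L[ℝ] Eucl n) x then 1
  else ∞

end

/-!
This is a Poletsky-type modulus inequality with the multiplicity factor of Väisälä's inequality.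

Put `σ = ρ / l(f')` at the regular points of `f` in `D` (differentiability, nonzero Jacobian) and
`σ = 0` elsewhere, and let `ρ'(y)` be `1/m` times the supremum of `∑ σ(x)` over sets of at most `m`
points `x` of the fibre `f⁻¹(y)`. The claim follows once `ρ'` is shown to be essentially admissible
for `f(Γ)` and its `p`-energy is bounded.

*Admissibility.* Sard's lemma and the `N⁻¹`-property show that almost every point of `D` is regular;
by the `N`-property, the image of the irregular points lies in a Borel null set `F`, and adding `∞`
on `F` to `ρ'` deals with the curves that spend positive time in `F`. For the other curves
`β = f ∘ α`, apart from the exceptional family of the `ACP`-property, the `f`-representation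
`φ = α*` is absolutely continuous and `f ∘ φ = β⁰` has unit speed, so that the chain rule gives
`|φ'| ≤ 1 / l(f'(φ))` almost everywhere. Hence `1 ≤ ∫_α ρ |dx| ≤ ∫ ρ(φ) |φ'| ≤ ∫ σ(φ)`
(`lineIntegral_le_lintegral_norm_deriv`, `norm_deriv_le_inv_minStretch`). Cutting `[0, c]` into `m`
pieces of length `h = c / m`, the points `φ(s + jh)`, `j < m`, are distinct points of the fibre over
`β⁰(s)`, so `∑ j, σ(φ(s + jh)) ≤ m ρ'(β⁰(s))`, and `β⁰` is `h`-periodic; therefore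
`∫ σ(φ) ≤ ∫ ρ'(β⁰)` (`lineIntegral_le_lineIntegral_fibreMean`).

*Energy.* By convexity of `t ↦ t ^ p`, `ρ'(y) ^ p` is at most `1/m` times the sum of `σ ^ p` over the
regular points of the fibre. The regular set is a countable disjoint union of Borel sets on which
`f` is injective (`exists_injective_partition`), and the change of variables formula on each of them
turns the integral of this sum into `∫ |J| σ ^ p = ∫ K ρ ^ p` (`lintegral_fibreMean_rpow_le`).
-/

open Filter Topology

/-! ### The length function and the normal representation -/

section Length

variable {n : ℕ} {γ : ℝ → Eucl n} {a b : ℝ}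

theorem lengthFun_left : lengthFun γ a b a = 0 := variationOnFromTo.self _ _ _

theorem lengthFun_monotoneOn (hγ : BoundedVariationOn γ (Icc a b)) :
    MonotoneOn (lengthFun γ a b) (Icc a b) := by
  intro x hx y hy hxy
  exact variationOnFromTo.monotoneOn hγ.locallyBoundedVariationOn
    (left_mem_Icc.2 (hx.1.trans hx.2)) hx hy hxy

theorem lengthFun_continuousOn (hc : ContinuousOn γ (Icc a b))
    (hγ : BoundedVariationOn γ (Icc a b)) : ContinuousOn (lengthFun γ a b) (Icc a b) := by
  intro t ht
  have ha : a ∈ Icc a b := left_mem_Icc.2 (ht.1.trans ht.2)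
  have hl := variationOnFromTo.tendsto_left ha ht hγ.locallyBoundedVariationOn
    ((hc t ht).tendsto.mono_left (nhdsWithin_mono _ inter_subset_left))
  have hr := variationOnFromTo.tendsto_right ha ht hγ.locallyBoundedVariationOn
    ((hc t ht).tendsto.mono_left (nhdsWithin_mono _ inter_subset_left))
  rw [dist_self, sub_zero] at hl
  rw [dist_self, add_zero] at hr
  have hsub : Icc a b ⊆ insert t ((Icc a b ∩ Iio t) ∪ (Icc a b ∩ Ioi t)) := by
    intro x hx
    rcases lt_trichotomy x t with h | h | h <;> simp_all
  refine ContinuousWithinAt.mono ?_ hsub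
  rw [continuousWithinAt_insert_self]
  exact ContinuousWithinAt.union hl hr

/-- The length function of a curve on `[a, b]` maps `[a, b]` onto `[0, l(γ)]`. -/
theorem lengthFun_image (hab : a ≤ b) (hc : ContinuousOn γ (Icc a b))
    (hγ : BoundedVariationOn γ (Icc a b)) :
    lengthFun γ a b '' Icc a b = Icc 0 (curveLength γ a b) := by
  apply Subset.antisymm
  · rintro _ ⟨t, ht, rfl⟩
    refine ⟨?_, lengthFun_monotoneOn hγ ht (right_mem_Icc.2 hab) ht.2⟩
    rw [← lengthFun_left (γ := γ) (a := a) (b := b)]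
    exact lengthFun_monotoneOn hγ (left_mem_Icc.2 hab) ht ht.1
  · have := intermediate_value_Icc hab (lengthFun_continuousOn hc hγ)
    rwa [lengthFun_left] at this

theorem curveLength_nonneg (hab : a ≤ b) : 0 ≤ curveLength γ a b :=
  variationOnFromTo.nonneg_of_le _ _ hab

/-- The normal representation has unit speed, hence it is `1`-Lipschitz. -/
theorem normalRep_lipschitzOnWith (hab : a ≤ b) (hc : ContinuousOn γ (Icc a b))
    (hγ : BoundedVariationOn γ (Icc a b)) :
    LipschitzOnWith 1 (normalRep γ a b) (Icc 0 (curveLength γ a b)) := by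
  have hu := has_unit_speed_naturalParameterization γ hγ.locallyBoundedVariationOn
    (left_mem_Icc.2 hab)
  change HasUnitSpeedOn (normalRep γ a b) (lengthFun γ a b '' Icc a b) at hu
  rw [lengthFun_image hab hc hγ] at hu
  have key : ∀ x ∈ Icc 0 (curveLength γ a b), ∀ y ∈ Icc 0 (curveLength γ a b), x ≤ y →
      edist (normalRep γ a b x) (normalRep γ a b y) ≤ edist x y := by
    intro x hx y hy hxy
    refine (eVariationOn.edist_le _ (s := Icc 0 (curveLength γ a b) ∩ Icc x y)
      ⟨hx, le_rfl, hxy⟩ ⟨hy, hxy, le_rfl⟩).trans ?_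
    rw [hu hx hy, edist_dist, dist_comm, Real.dist_eq, abs_of_nonneg (sub_nonneg.2 hxy)]
    simp
  intro x hx y hy
  rw [ENNReal.coe_one, one_mul]
  rcases le_total x y with h | h
  · exact key x hx y hy h
  · rw [edist_comm, edist_comm x]; exact key y hy x hx h

theorem lengthFun_congr {γ' : ℝ → Eucl n} (h : EqOn γ γ' (Icc a b)) :
    lengthFun γ a b = lengthFun γ' a b := by
  funext t
  unfold lengthFun variationOnFromTo
  rw [eVariationOn.congr (h.mono inter_subset_left), eVariationOn.congr (h.mono inter_subset_left)]

theorem curveLength_congr {γ' : ℝ → Eucl n} (h : EqOn γ γ' (Icc a b)) :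
    curveLength γ a b = curveLength γ' a b := by
  unfold curveLength; rw [lengthFun_congr h]

theorem normalRep_congr {γ' : ℝ → Eucl n} (hab : a ≤ b) (hc : ContinuousOn γ (Icc a b))
    (hγ : BoundedVariationOn γ (Icc a b)) (h : EqOn γ γ' (Icc a b)) :
    EqOn (normalRep γ a b) (normalRep γ' a b) (Icc 0 (curveLength γ a b)) := by
  rw [← lengthFun_image hab hc hγ]
  rintro _ ⟨t, ht, rfl⟩
  have hγ' : BoundedVariationOn γ' (Icc a b) := by
    unfold BoundedVariationOn; rw [← eVariationOn.congr h]; exact hγ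
  rw [normalRep_lengthFun hγ ht, lengthFun_congr h, normalRep_lengthFun hγ' ht, h ht]

/-- Additivity of length, in the form of the variation over a subinterval. -/
theorem eVariationOn_Icc_eq_lengthFun_sub (hγ : BoundedVariationOn γ (Icc a b)) {s t : ℝ}
    (hs : s ∈ Icc a b) (ht : t ∈ Icc a b) (hst : s ≤ t) :
    (eVariationOn γ (Icc s t)).toReal = lengthFun γ a b t - lengthFun γ a b s := by
  unfold lengthFun
  rw [variationOnFromTo.sub_right hγ.locallyBoundedVariationOn
    (left_mem_Icc.2 (hs.1.trans hs.2)) ht hs, variationOnFromTo.eq_of_le _ _ hst,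
    inter_eq_self_of_subset_right (Icc_subset_Icc hs.1 ht.2)]

end Length

/-! ### A change of variables inequality on the line -/

/-- A measure on `ℝ` whose values on half-open intervals are dominated by the integrals of `w` is
dominated by `w dx`: the Stieltjes measure of a primitive of `w` is the largest such measure, by
construction of the Stieltjes outer measure. -/
theorem measure_le_withDensity_of_Ioc_le {μ : Measure ℝ} {w : ℝ → ℝ} (hw : Integrable w)
    (hw0 : 0 ≤ w)
    (h : ∀ a b, a ≤ b → μ (Ioc a b) ≤ ENNReal.ofReal (∫ x in a..b, w x)) :
    μ ≤ volume.withDensity (fun x => ENNReal.ofReal (w x)) := by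
  have hi : ∀ a b, IntervalIntegrable w volume a b := fun a b => hw.intervalIntegrable
  have hsub : ∀ a b, (∫ x in (0 : ℝ)..b, w x) - ∫ x in (0 : ℝ)..a, w x = ∫ x in a..b, w x :=
    fun a b => intervalIntegral.integral_interval_sub_left (hi _ _) (hi _ _)
  let F : StieltjesFunction ℝ :=
    { toFun := fun x => ∫ t in (0 : ℝ)..x, w t
      mono' := fun a b hab => by
        have := intervalIntegral.integral_nonneg hab (μ := volume) (fun x _ => hw0 x)
        rw [← hsub a b] at this
        exact sub_nonneg.1 this
      right_continuous' := fun x =>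
        (intervalIntegral.continuous_primitive hi 0).continuousWithinAt }
  have hF : ∀ a b, F b - F a = ∫ x in a..b, w x := hsub
  have hFm : F.measure = volume.withDensity (fun x => ENNReal.ofReal (w x)) := by
    refine Measure.ext_of_Ioc _ _ fun a b hab => ?_
    rw [StieltjesFunction.measure_Ioc, hF, withDensity_apply _ measurableSet_Ioc,
      intervalIntegral.integral_of_le hab.le,
      ofReal_integral_eq_lintegral_ofReal hw.integrableOn (ae_of_all _ hw0)]
  rw [← hFm]
  refine Measure.le_iff.2 fun s _ => ?_
  rw [StieltjesFunction.measure]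
  change μ.toOuterMeasure s ≤ F.outer s
  refine (OuterMeasure.le_ofFunction.2 fun s => ?_) s
  rw [StieltjesFunction.length_eq]
  refine le_iInf fun a => le_iInf fun b => le_iInf fun hs => ?_
  have hs' : s ⊆ Ioc a b := fun x hx => hs ⟨hx, notMem_botSet_of_lt (sub_one_lt x)⟩
  rcases le_or_gt a b with hab | hab
  · rw [hF]; exact (measure_mono hs').trans (h a b hab)
  · rw [Ioc_eq_empty (not_lt.2 hab.le), subset_empty_iff] at hs'
    simp [hs']

/-- If `σ` is monotone on `[0, L]` and `u' - u ≤ ∫_{σ u}^{σ u'} w` for `u ≤ u'`, then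
`∫_0^L g (σ u) du ≤ ∫ g w dx`: the image under `σ` of Lebesgue measure is at most `w dx`. -/
theorem lintegral_comp_le_of_sub_le_integral {L : ℝ} {σ w : ℝ → ℝ} {g : ℝ → ℝ≥0∞}
    (hg : Measurable g) (hw : Integrable w) (hw0 : 0 ≤ w) (hσ : MonotoneOn σ (Icc 0 L))
    (h : ∀ u ∈ Icc 0 L, ∀ u' ∈ Icc 0 L, u ≤ u' → u' - u ≤ ∫ x in σ u..σ u', w x) :
    ∫⁻ u in Icc 0 L, g (σ u) ≤ ∫⁻ x, g x * ENNReal.ofReal (w x) := by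
  have hσm : AEMeasurable σ (volume.restrict (Icc 0 L)) :=
    aemeasurable_restrict_of_monotoneOn measurableSet_Icc hσ
  have hle : Measure.map σ (volume.restrict (Icc 0 L)) ≤
      volume.withDensity (fun x => ENNReal.ofReal (w x)) := by
    refine measure_le_withDensity_of_Ioc_le hw hw0 fun a b hab => ?_
    rw [Measure.map_apply_of_aemeasurable hσm measurableSet_Ioc,
      Measure.restrict_apply₀' measurableSet_Icc.nullMeasurableSet]
    refine (Real.volume_le_diam _).trans (Metric.ediam_le ?_)
    have key : ∀ u ∈ σ ⁻¹' Ioc a b ∩ Icc 0 L, ∀ u' ∈ σ ⁻¹' Ioc a b ∩ Icc 0 L, u ≤ u' →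
        edist u u' ≤ ENNReal.ofReal (∫ x in a..b, w x) := by
      rintro u ⟨⟨hu1, hu2⟩, hu⟩ u' ⟨⟨hu1', hu2'⟩, hu'⟩ huu'
      rw [edist_dist, dist_comm, Real.dist_eq, abs_of_nonneg (sub_nonneg.2 huu')]
      refine ENNReal.ofReal_le_ofReal ((h u hu u' hu' huu').trans ?_)
      exact intervalIntegral.integral_mono_interval hu1.le (hσ hu hu' huu') hu2'
        (ae_of_all _ hw0) hw.intervalIntegrable
    intro u hu u' hu'
    rcases le_total u u' with huu' | huu'
    · exact key u hu u' hu' huu'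
    · rw [edist_comm]; exact key u' hu' u hu huu'
  calc ∫⁻ u in Icc 0 L, g (σ u) = ∫⁻ x, g x ∂(Measure.map σ (volume.restrict (Icc 0 L))) :=
        (lintegral_map' hg.aemeasurable hσm).symm
    _ ≤ ∫⁻ x, g x ∂(volume.withDensity (fun x => ENNReal.ofReal (w x))) := lintegral_mono' hle le_rfl
    _ = ∫⁻ x, g x * ENNReal.ofReal (w x) := by
        rw [lintegral_withDensity_eq_lintegral_mul₀ hw.aemeasurable.ennreal_ofReal hg.aemeasurable]
        simp [mul_comm]

/-! ### Absolutely continuous curves -/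

theorem LipschitzWith.comp_absolutelyContinuousOnInterval {X Y : Type*} [PseudoMetricSpace X]
    [PseudoMetricSpace Y] {K : NNReal} {φ : X → Y} (hφ : LipschitzWith K φ) {f : ℝ → X} {a b : ℝ}
    (hf : AbsolutelyContinuousOnInterval f a b) : AbsolutelyContinuousOnInterval (φ ∘ f) a b := by
  have h0 := Filter.Tendsto.const_mul (K : ℝ) hf
  rw [mul_zero] at h0
  refine squeeze_zero (fun E => Finset.sum_nonneg fun _ _ => dist_nonneg) (fun E => ?_) h0
  rw [Finset.mul_sum]
  exact Finset.sum_le_sum fun i _ => hφ.dist_le_mul _ _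

section AC

variable {n : ℕ} {φ : ℝ → Eucl n} {a b : ℝ}

theorem AbsolutelyContinuousOnInterval.inner_const (hφ : AbsolutelyContinuousOnInterval φ a b)
    (e : Eucl n) : AbsolutelyContinuousOnInterval (fun t => inner ℝ e (φ t)) a b :=
  (innerSL ℝ e).lipschitz.comp_absolutelyContinuousOnInterval hφ

theorem AbsolutelyContinuousOnInterval.ae_deriv_inner (hφ : AbsolutelyContinuousOnInterval φ a b)
    (e : Eucl n) :
    ∀ᵐ t, t ∈ uIcc a b → deriv (fun t => inner ℝ e (φ t)) t = inner ℝ e (deriv φ t) := by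
  filter_upwards [hφ.boundedVariationOn.ae_differentiableAt_of_mem_uIcc] with t ht hts
  exact (((innerSL ℝ e).hasFDerivAt).comp_hasDerivAt t (ht hts).hasDerivAt).deriv

theorem AbsolutelyContinuousOnInterval.intervalIntegrable_norm_deriv
    (hφ : AbsolutelyContinuousOnInterval φ a b) :
    IntervalIntegrable (fun t => ‖deriv φ t‖) volume a b := by
  have hsum : IntervalIntegrable (fun t => ∑ i, |deriv (fun t =>
      inner ℝ (EuclideanSpace.single i (1 : ℝ)) (φ t)) t|) volume a b := by
    have := IntervalIntegrable.sum (Finset.univ : Finset (Fin n)) (fun i _ =>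
      ((hφ.inner_const (EuclideanSpace.single i (1 : ℝ))).intervalIntegrable_deriv).abs)
    exact this.congr (by intro t _; simp)
  refine hsum.mono_fun (measurable_deriv φ).norm.aestronglyMeasurable ?_
  have hae := ae_all_iff.2 fun i : Fin n => hφ.ae_deriv_inner (EuclideanSpace.single i (1 : ℝ))
  rw [EventuallyLE, ae_restrict_iff' measurableSet_uIoc]
  filter_upwards [hae] with t ht hts
  rw [norm_norm, Real.norm_of_nonneg (Finset.sum_nonneg fun _ _ => abs_nonneg _)]
  have hcoord : ∀ i, |deriv (fun t => inner ℝ (EuclideanSpace.single i (1 : ℝ)) (φ t)) t| =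
      ‖(deriv φ t) i‖ := fun i => by
    rw [ht i (uIoc_subset_uIcc hts), EuclideanSpace.inner_single_left]
    simp
  simp_rw [hcoord]
  rw [EuclideanSpace.norm_eq]
  refine Real.sqrt_le_iff.2 ⟨Finset.sum_nonneg fun _ _ => norm_nonneg _, ?_⟩
  exact Finset.sum_sq_le_sq_sum_of_nonneg fun _ _ => norm_nonneg _

/-- An absolutely continuous curve moves by at most the integral of its speed. Testing against the
direction of the displacement reduces this to the fundamental theorem for real functions. -/
theorem AbsolutelyContinuousOnInterval.dist_le_integral_norm_deriv (hab : a ≤ b)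
    (hφ : AbsolutelyContinuousOnInterval φ a b) :
    dist (φ a) (φ b) ≤ ∫ t in a..b, ‖deriv φ t‖ := by
  rcases eq_or_ne (φ b - φ a) 0 with h0 | h0
  · rw [dist_comm, dist_eq_norm, h0, norm_zero]
    exact intervalIntegral.integral_nonneg hab fun _ _ => norm_nonneg _
  set e : Eucl n := ‖φ b - φ a‖⁻¹ • (φ b - φ a) with he
  have he1 : ‖e‖ = 1 := norm_smul_inv_norm (𝕜 := ℝ) h0
  have hftc := (hφ.inner_const e).integral_deriv_eq_sub
  have h1 : inner ℝ e (φ b) - inner ℝ e (φ a) = ‖φ b - φ a‖ := by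
    rw [← inner_sub_right, he, real_inner_smul_left, real_inner_self_eq_norm_sq]
    field_simp
  rw [dist_comm, dist_eq_norm, ← h1, ← hftc]
  refine intervalIntegral.integral_mono_ae_restrict hab (hφ.inner_const e).intervalIntegrable_deriv
    hφ.intervalIntegrable_norm_deriv ?_
  rw [EventuallyLE, ae_restrict_iff' measurableSet_Icc]
  filter_upwards [hφ.ae_deriv_inner e] with t ht hts
  rw [ht (by rwa [uIcc_of_le hab])]
  simpa [he1] using real_inner_le_norm e (deriv φ t)

/-- The length of an absolutely continuous curve is at most the integral of its speed. -/
theorem AbsolutelyContinuousOnInterval.eVariationOn_le (hab : a ≤ b)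
    (hφ : AbsolutelyContinuousOnInterval φ a b) :
    eVariationOn φ (Icc a b) ≤ ENNReal.ofReal (∫ t in a..b, ‖deriv φ t‖) := by
  have hint := hφ.intervalIntegrable_norm_deriv
  have hmem : ∀ {x y}, x ∈ Icc a b → y ∈ Icc a b → uIcc x y ⊆ uIcc a b := fun hx hy => by
    rw [uIcc_of_le hab]; exact uIcc_subset_Icc hx hy
  have hdiff : ∀ x ∈ Icc a b, ∀ y ∈ Icc a b, x ≤ y →
      dist (φ x) (φ y) ≤ (∫ t in a..y, ‖deriv φ t‖) - ∫ t in a..x, ‖deriv φ t‖ := by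
    intro x hx y hy hxy
    rw [intervalIntegral.integral_interval_sub_left
      (hint.mono_set (hmem (left_mem_Icc.2 hab) hy)) (hint.mono_set (hmem (left_mem_Icc.2 hab) hx))]
    exact (hφ.mono (hmem hx hy)).dist_le_integral_norm_deriv hxy
  have hF : MonotoneOn (fun x => ∫ t in a..x, ‖deriv φ t‖) (Icc a b) := fun x hx y hy hxy =>
    sub_nonneg.1 (dist_nonneg.trans (hdiff x hx y hy hxy))
  have h1 : eVariationOn φ (Icc a b) ≤
      eVariationOn (fun x => ∫ t in a..x, ‖deriv φ t‖) (Icc a b) := by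
    refine iSup_mono fun q => Finset.sum_le_sum fun i _ => ?_
    rw [edist_dist, edist_dist, dist_comm]
    refine ENNReal.ofReal_le_ofReal ?_
    exact (hdiff _ (q.2.2.2 i) _ (q.2.2.2 (i + 1)) (q.2.2.1 i.le_succ)).trans (le_abs_self _)
  have h2 := hF.eVariationOn_eq (left_mem_Icc.2 hab) (right_mem_Icc.2 hab)
  rw [inter_self, intervalIntegral.integral_same, sub_zero] at h2
  exact h1.trans h2.le

end AC

/-! ### Line integrals along reparametrized curves -/

/-- If `α = φ ∘ ℓ` on `[a, b]` with `ℓ` monotone and `φ` absolutely continuous, then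
`∫_α ρ |dx| ≤ ∫_0^c ρ(φ(s)) |φ'(s)| ds`. On each closed subcurve, the arc length `u` is carried to
the parameter `s = σ(u)` of `φ`, and the length of `φ` between two parameters is at most the
integral of its speed. -/
theorem lineIntegral_le_lintegral_norm_deriv {n : ℕ} {ρ : Eucl n → ℝ≥0∞} (hρ : Measurable ρ)
    {α : Curve n} {a b c : ℝ} (hdom : α.dom = Icc a b) (hα : BoundedVariationOn α.toFun (Icc a b))
    (hc : 0 ≤ c) {φ : ℝ → Eucl n} (hφ : AbsolutelyContinuousOnInterval φ 0 c) {ℓ : ℝ → ℝ}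
    (hℓ : MonotoneOn ℓ (Icc a b)) (hmaps : MapsTo ℓ (Icc a b) (Icc 0 c))
    (heq : ∀ t ∈ Icc a b, α.toFun t = φ (ℓ t)) :
    lineIntegral ρ α ≤ ∫⁻ s in Icc 0 c, ρ (φ s) * ENNReal.ofReal ‖deriv φ s‖ := by
  unfold lineIntegral
  refine iSup₂_le fun a' ha' => iSup₂_le fun b' hb' => iSup_le fun hab' => ?_
  rw [hdom] at ha' hb'
  have hsub : Icc a' b' ⊆ Icc a b := Icc_subset_Icc ha'.1 hb'.2
  have hcont : ContinuousOn α.toFun (Icc a' b') := α.continuousOn.mono (hdom ▸ hsub)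
  have hbv : BoundedVariationOn α.toFun (Icc a' b') := hα.mono hsub
  set γ := α.toFun
  set L := curveLength γ a' b'
  have himg : ∀ u ∈ Icc 0 L, ∃ t ∈ Icc a' b', lengthFun γ a' b' t = u := by
    intro u hu
    rw [← lengthFun_image hab' hcont hbv] at hu
    exact hu
  choose! τ hτ hτu using himg
  have hτmono : MonotoneOn τ (Icc 0 L) := by
    intro u hu u' hu' huu'
    rcases huu'.eq_or_lt with rfl | hlt
    · exact le_rfl
    · by_contra! hcon
      have := lengthFun_monotoneOn hbv (hτ u' hu') (hτ u hu) hcon.le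
      rw [hτu u hu, hτu u' hu'] at this
      exact absurd hlt (not_lt.2 this)
  have hσ : MonotoneOn (ℓ ∘ τ) (Icc 0 L) := fun u hu u' hu' huu' =>
    hℓ (hsub (hτ u hu)) (hsub (hτ u' hu')) (hτmono hu hu' huu')
  have hσmem : ∀ u ∈ Icc 0 L, (ℓ ∘ τ) u ∈ Icc 0 c := fun u hu => hmaps (hsub (hτ u hu))
  have huIcc : uIcc 0 c = Icc 0 c := uIcc_of_le hc
  have hφc : ContinuousOn φ (Icc 0 c) := huIcc ▸ hφ.continuousOn
  set w : ℝ → ℝ := (Icc 0 c).indicator fun s => ‖deriv φ s‖ with hw_def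
  have hw : Integrable w := by
    rw [integrable_indicator_iff measurableSet_Icc]
    exact (intervalIntegrable_iff_integrableOn_Icc_of_le hc).1 hφ.intervalIntegrable_norm_deriv
  have hw0 : 0 ≤ w := fun s => indicator_nonneg (fun _ _ => norm_nonneg _) s
  set g : ℝ → ℝ≥0∞ := fun s => ρ (IccExtend hc ((Icc 0 c).domRestrict φ) s) with hg_def
  have hgm : Measurable g :=
    hρ.comp ((continuousOn_iff_continuous_domRestrict.1 hφc).Icc_extend' (h := hc)).measurable
  have hgφ : ∀ s ∈ Icc 0 c, g s = ρ (φ s) := fun s hs => by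
    simp only [hg_def, IccExtend_of_mem hc _ hs]
    rfl
  have key : ∀ u ∈ Icc 0 L, ∀ u' ∈ Icc 0 L, u ≤ u' →
      u' - u ≤ ∫ x in (ℓ ∘ τ) u..(ℓ ∘ τ) u', w x := by
    intro u hu u' hu' huu'
    have hσle := hσ hu hu' huu'
    have hsub2 : Icc (τ u) (τ u') ⊆ Icc a b := (Icc_subset_Icc (hτ u hu).1 (hτ u' hu').2).trans hsub
    have hsub3 : Icc ((ℓ ∘ τ) u) ((ℓ ∘ τ) u') ⊆ Icc 0 c :=
      Icc_subset_Icc (hσmem u hu).1 (hσmem u' hu').2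
    have h1 := eVariationOn_Icc_eq_lengthFun_sub hbv (hτ u hu) (hτ u' hu') (hτmono hu hu' huu')
    rw [hτu u hu, hτu u' hu'] at h1
    have h2 : eVariationOn γ (Icc (τ u) (τ u')) ≤
        eVariationOn φ (Icc ((ℓ ∘ τ) u) ((ℓ ∘ τ) u')) := by
      rw [eVariationOn.congr (fun t ht => heq t (hsub2 ht) : EqOn γ (φ ∘ ℓ) (Icc (τ u) (τ u')))]
      refine eVariationOn.comp_le_of_monotoneOn φ ℓ (hℓ.mono hsub2) fun t ht => ?_
      exact ⟨hℓ (hsub (hτ u hu)) (hsub2 ht) ht.1, hℓ (hsub2 ht) (hsub (hτ u' hu')) ht.2⟩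
    have h3 := (hφ.mono (c := (ℓ ∘ τ) u) (d := (ℓ ∘ τ) u')
      (by rw [uIcc_of_le hσle, huIcc]; exact hsub3)).eVariationOn_le hσle
    have h4 : ∫ x in (ℓ ∘ τ) u..(ℓ ∘ τ) u', w x = ∫ x in (ℓ ∘ τ) u..(ℓ ∘ τ) u', ‖deriv φ x‖ := by
      refine intervalIntegral.integral_congr fun x hx => ?_
      rw [uIcc_of_le hσle] at hx
      exact indicator_of_mem (hsub3 hx) _
    rw [← h1, h4]
    exact ENNReal.toReal_le_of_le_ofReal
      (intervalIntegral.integral_nonneg hσle fun _ _ => norm_nonneg _) (h2.trans h3)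
  calc ∫⁻ s in Icc 0 L, ρ (normalRep γ a' b' s)
      = ∫⁻ u in Icc 0 L, g ((ℓ ∘ τ) u) := by
        refine setLIntegral_congr_fun measurableSet_Icc fun u hu => ?_
        rw [hgφ _ (hσmem u hu), Function.comp_apply, ← heq _ (hsub (hτ u hu)),
          ← normalRep_lengthFun hbv (hτ u hu), hτu u hu]
    _ ≤ ∫⁻ x, g x * ENNReal.ofReal (w x) := lintegral_comp_le_of_sub_le_integral hgm hw hw0 hσ key
    _ = ∫⁻ s in Icc 0 c, ρ (φ s) * ENNReal.ofReal ‖deriv φ s‖ := by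
        rw [← lintegral_indicator measurableSet_Icc]
        refine lintegral_congr fun s => ?_
        by_cases hs : s ∈ Icc 0 c
        · rw [hw_def, indicator_of_mem hs, indicator_of_mem hs, hgφ s hs]
        · rw [hw_def, indicator_of_notMem hs, indicator_of_notMem hs, ENNReal.ofReal_zero, mul_zero]

/-! ### The minimal stretching -/

section MinStretch

variable {n : ℕ}

theorem minStretch_le {A : Eucl n →L[ℝ] Eucl n} {v : Eucl n} (hv : ‖v‖ = 1) :
    minStretch A ≤ ‖A v‖ :=
  csInf_le ⟨0, by rintro _ ⟨w, _, rfl⟩; exact norm_nonneg _⟩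
    ⟨v, by simpa using hv, rfl⟩

theorem minStretch_mul_norm_le (A : Eucl n →L[ℝ] Eucl n) (v : Eucl n) :
    minStretch A * ‖v‖ ≤ ‖A v‖ := by
  rcases eq_or_ne v 0 with rfl | hv
  · simp
  have h := minStretch_le (A := A) (v := ‖v‖⁻¹ • v) (norm_smul_inv_norm (𝕜 := ℝ) hv)
  rw [map_smul, norm_smul, norm_inv, norm_norm, inv_mul_eq_div] at h
  exact (le_div_iff₀ (norm_pos_iff.2 hv)).1 h

theorem sphere_nonempty (hn : 0 < n) : (Metric.sphere (0 : Eucl n) 1).Nonempty :=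
  ⟨EuclideanSpace.single ⟨0, hn⟩ 1, by simp⟩

theorem minStretch_pos (hn : 0 < n) {A : Eucl n →L[ℝ] Eucl n} (hA : A.det ≠ 0) : 0 < minStretch A := by
  have hmem := ((isCompact_sphere (0 : Eucl n) 1).image A.continuous.norm).sInf_mem
    ((sphere_nonempty hn).image _)
  obtain ⟨v, hv, hAv⟩ := hmem
  rw [minStretch, ← hAv, norm_pos_iff]
  intro h0
  have hv0 : v = 0 := (A.toContinuousLinearEquivOfDetNeZero hA).injective (by simpa using h0)
  simp [hv0] at hv

theorem minStretch_le_add (hn : 0 < n) (A B : Eucl n →L[ℝ] Eucl n) :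
    minStretch A ≤ minStretch B + ‖A - B‖ := by
  rw [← sub_le_iff_le_add]
  refine le_csInf ((sphere_nonempty hn).image _) ?_
  rintro _ ⟨v, hv, rfl⟩
  have hv1 : ‖v‖ = 1 := by simpa using hv
  have h1 := minStretch_le (A := A) hv1
  have h2 : ‖A v‖ ≤ ‖B v‖ + ‖(A - B) v‖ := by
    simpa using norm_add_le (B v) ((A - B) v)
  have h3 := (A - B).le_opNorm v
  rw [hv1, mul_one] at h3
  dsimp only
  linarith

theorem continuous_minStretch (hn : 0 < n) : Continuous (minStretch (n := n)) :=
  (LipschitzWith.of_le_add_mul 1 fun A B => by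
    simpa [dist_eq_norm] using minStretch_le_add hn A B).continuous

end MinStretch

/-- If `f ∘ φ` moves with speed at most one then `|φ'| ≤ 1 / l(f'(φ))`, by the chain rule. -/
theorem norm_deriv_le_inv_minStretch {n : ℕ} (hn : 0 < n) {f : Eucl n → Eucl n}
    {φ ψ : ℝ → Eucl n} {s : ℝ} {U : Set ℝ} (hU : U ∈ 𝓝 s) (hψ : LipschitzOnWith 1 ψ U)
    (hfφ : EqOn (f ∘ φ) ψ U) (hφ : DifferentiableAt ℝ φ s) (hf : DifferentiableAt ℝ f (φ s))
    (hdet : (fderiv ℝ f (φ s)).det ≠ 0) :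
    ‖deriv φ s‖ ≤ 1 / minStretch (fderiv ℝ f (φ s)) := by
  have hd : HasDerivAt (f ∘ φ) (fderiv ℝ f (φ s) (deriv φ s)) s :=
    hf.hasFDerivAt.comp_hasDerivAt s hφ.hasDerivAt
  have hle : ‖fderiv ℝ f (φ s) (deriv φ s)‖ ≤ 1 := by
    rw [← hd.deriv, (hfφ.eventuallyEq_of_mem hU).deriv_eq]
    simpa using norm_deriv_le_of_lipschitzOn hU hψ
  rw [le_div_iff₀ (minStretch_pos hn hdet), mul_comm]
  exact (minStretch_mul_norm_le _ _).trans hle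

/-! ### Regular points and the change of variables in space -/

section Regular

variable {n : ℕ}

/-- The regular points of `f` in `D`: the points of differentiability with nonzero Jacobian. -/
def regularSet (D : Set (Eucl n)) (f : Eucl n → Eucl n) : Set (Eucl n) :=
  {x ∈ D | DifferentiableAt ℝ f x ∧ (fderiv ℝ f x).det ≠ 0}

theorem measurableSet_regularSet {D : Set (Eucl n)} (hD : IsOpen D) (f : Eucl n → Eucl n) :
    MeasurableSet (regularSet D f) :=
  hD.measurableSet.inter ((measurableSet_of_differentiableAt ℝ f).inter
    ((ContinuousLinearMap.continuous_det.measurable.comp (measurable_fderiv ℝ f))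
      (measurableSet_singleton 0).compl))

/-- Almost every point is regular: by Sard's lemma the critical points of differentiability have a
null image, and the `N⁻¹`-property brings this back to `D`. -/
theorem volume_diff_regularSet {D : Set (Eucl n)} (hD : IsOpen D) {f : Eucl n → Eucl n}
    (hdiff : ∀ᵐ x ∂(volume.restrict D), DifferentiableAt ℝ f x) (hNinv : LuzinNInv D f) :
    volume (D \ regularSet D f) = 0 := by
  rw [ae_restrict_iff' hD.measurableSet, ae_iff] at hdiff
  set C : Set (Eucl n) := {x | DifferentiableAt ℝ f x ∧ (fderiv ℝ f x).det = 0}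
  have hC : volume (f '' C) = 0 :=
    addHaar_image_eq_zero_of_det_fderivWithin_eq_zero volume
      (fun x hx => hx.1.hasFDerivAt.hasFDerivWithinAt) (fun x hx => hx.2)
  refine measure_mono_null (fun x hx => ?_) (measure_union_null hdiff (hNinv _ hC))
  by_cases hd : DifferentiableAt ℝ f x
  · right
    refine ⟨hx.1, x, ⟨hd, ?_⟩, rfl⟩
    by_contra hdet
    exact hx.2 ⟨hx.1, hd, hdet⟩
  · left
    exact fun h => hd (h hx.1)

/-- The regular set splits into countably many Borel pieces on each of which `f` is injective. -/
theorem exists_injective_partition {D : Set (Eucl n)} (hD : IsOpen D) (f : Eucl n → Eucl n) :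
    ∃ E : ℕ → Set (Eucl n), Pairwise (Function.onFun Disjoint E) ∧ (∀ i, MeasurableSet (E i)) ∧
      (⋃ i, E i) = regularSet D f ∧ ∀ i, InjOn f (E i) := by
  classical
  rcases (regularSet D f).eq_empty_or_nonempty with hempty | hne
  · exact ⟨fun _ => ∅, fun _ _ _ => disjoint_bot_left, fun _ => MeasurableSet.empty,
      by simp [hempty], fun _ => injOn_empty f⟩
  -- A map that is approximated by an invertible `A` within less than `‖A⁻¹‖⁻¹` is injective; the norm
  -- `‖A⁻¹‖` vanishes only in dimension zero.
  let r : (Eucl n →L[ℝ] Eucl n) → NNReal := fun A =>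
    if h : A.det ≠ 0 then
      if ‖((A.toContinuousLinearEquivOfDetNeZero h).symm : Eucl n →L[ℝ] Eucl n)‖₊ = 0 then 1 else
      ‖((A.toContinuousLinearEquivOfDetNeZero h).symm : Eucl n →L[ℝ] Eucl n)‖₊⁻¹ / 2
    else 1
  have hr : ∀ A, r A ≠ 0 := by
    intro A
    simp only [r]
    split_ifs with h h'
    · exact one_ne_zero
    · exact div_ne_zero (inv_ne_zero h') two_ne_zero
    · exact one_ne_zero
  obtain ⟨t, A, hdisj, hmeas, hcover, happ, hA⟩ :=
    exists_partition_approximatesLinearOn_of_hasFDerivWithinAt f (regularSet D f) (fderiv ℝ f)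
      (fun x hx => hx.2.1.hasFDerivAt.hasFDerivWithinAt) r hr
  refine ⟨fun i => regularSet D f ∩ t i, fun i j hij => (hdisj hij).mono inter_subset_right
    inter_subset_right, fun i => (measurableSet_regularSet hD f).inter (hmeas i), ?_, fun i => ?_⟩
  · rw [← inter_iUnion, inter_eq_left]; exact hcover
  · obtain ⟨y, hy, hAy⟩ := hA hne i
    have hdet : (A i).det ≠ 0 := hAy ▸ hy.2.2
    have happ' := happ i
    rw [← ContinuousLinearMap.coe_toContinuousLinearEquivOfDetNeZero (A i) hdet] at happ'
    refine ApproximatesLinearOn.injOn happ' ?_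
    rw [ContinuousLinearMap.coe_toContinuousLinearEquivOfDetNeZero]
    simp only [r, dif_pos hdet]
    split_ifs with h
    · left
      refine ⟨fun x y => ?_⟩
      have h0 : ∀ z : Eucl n, z = 0 := fun z => by
        have hz := ((A i).toContinuousLinearEquivOfDetNeZero hdet).symm_apply_apply z
        have h1 : ((A i).toContinuousLinearEquivOfDetNeZero hdet).symm
            ((A i).toContinuousLinearEquivOfDetNeZero hdet z) = 0 := by
          have := DFunLike.congr_fun (nnnorm_eq_zero.1 h)
            ((A i).toContinuousLinearEquivOfDetNeZero hdet z)
          simpa using this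
        rw [← hz, h1]
      rw [h0 x, h0 y]
    · right
      exact NNReal.half_lt_self (inv_ne_zero h)

end Regular

section Push

variable {n : ℕ} {f : Eucl n → Eucl n} {σ : Eucl n → ℝ≥0∞}

/-- The push-forward of `σ|_E` under an `f` that is injective on `E`: the value of `σ` at the point
of `E ∩ f⁻¹(y)`, and `0` if there is no such point. -/
noncomputable def pushOn (f : Eucl n → Eucl n) (E : Set (Eucl n)) (σ : Eucl n → ℝ≥0∞) (y : Eucl n) : ℝ≥0∞ :=
  ⨆ (x) (_ : x ∈ E ∧ f x = y), σ x

theorem le_pushOn {E : Set (Eucl n)} {x : Eucl n} (hx : x ∈ E) : σ x ≤ pushOn f E σ (f x) :=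
  le_iSup₂_of_le x ⟨hx, rfl⟩ le_rfl

theorem pushOn_apply {E : Set (Eucl n)} (hinj : InjOn f E) {x : Eucl n} (hx : x ∈ E) :
    pushOn f E σ (f x) = σ x := by
  refine le_antisymm (iSup₂_le fun z hz => ?_) (le_pushOn hx)
  rw [hinj hz.1 hx hz.2]

theorem pushOn_of_notMem {E : Set (Eucl n)} {y : Eucl n} (hy : y ∉ f '' E) :
    pushOn f E σ y = 0 := by
  refine le_antisymm (iSup₂_le ?_) zero_le
  rintro x ⟨hx, rfl⟩
  exact absurd (mem_image_of_mem f hx) hy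

theorem measurable_pushOn {E : Set (Eucl n)} (hE : MeasurableSet E) (hf : ContinuousOn f E)
    (hinj : InjOn f E) (hσ : Measurable σ) : Measurable (pushOn f E σ) := by
  refine measurable_of_Ioi fun a => ?_
  have : pushOn f E σ ⁻¹' Ioi a = f '' (E ∩ σ ⁻¹' Ioi a) := by
    ext y
    simp only [pushOn, mem_preimage, mem_Ioi, lt_iSup_iff, mem_image, mem_inter_iff, exists_prop]
    constructor
    · rintro ⟨x, ⟨hx, hy⟩, h⟩; exact ⟨x, ⟨hx, h⟩, hy⟩
    · rintro ⟨x, ⟨hx, h⟩, hy⟩; exact ⟨x, ⟨hx, hy⟩, h⟩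
  rw [this]
  exact (hE.inter (hσ measurableSet_Ioi)).image_of_continuousOn_injOn
    (hf.mono inter_subset_left) (hinj.mono inter_subset_left)

theorem lintegral_pushOn_rpow {p : ℝ} (hp : 0 < p) {E : Set (Eucl n)} (hE : MeasurableSet E)
    (hd : ∀ x ∈ E, DifferentiableAt ℝ f x) (hinj : InjOn f E) :
    ∫⁻ y, pushOn f E σ y ^ p = ∫⁻ x in E, ENNReal.ofReal |(fderiv ℝ f x).det| * σ x ^ p := by
  have hd' : ∀ x ∈ E, HasFDerivWithinAt f (fderiv ℝ f x) E x :=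
    fun x hx => (hd x hx).hasFDerivAt.hasFDerivWithinAt
  have himg : MeasurableSet (f '' E) := measurable_image_of_fderivWithin hE hd' hinj
  have hind : (fun y => pushOn f E σ y ^ p) =
      (f '' E).indicator fun y => pushOn f E σ y ^ p := by
    refine (indicator_eq_self.2 fun y hy => ?_).symm
    by_contra hy'
    exact hy (by simp [pushOn_of_notMem hy', hp])
  rw [hind, lintegral_indicator himg,
    lintegral_image_eq_lintegral_abs_det_fderiv_mul volume hE hd' hinj]
  refine setLIntegral_congr_fun hE fun x hx => ?_
  rw [pushOn_apply hinj hx]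

/-- The mean, with denominator `m`, of the `m` largest values of `σ` over the points of a fibre of
`f`, the points being taken from pieces `E i` on which `f` is injective. -/
noncomputable def fibreMean (m : ℕ) (f : Eucl n → Eucl n) (E : ℕ → Set (Eucl n)) (σ : Eucl n → ℝ≥0∞)
    (y : Eucl n) : ℝ≥0∞ :=
  ⨆ (I : Finset ℕ) (_ : I.card ≤ m), (m : ℝ≥0∞)⁻¹ * ∑ i ∈ I, pushOn f (E i) σ y

theorem measurable_fibreMean (m : ℕ) {E : ℕ → Set (Eucl n)} (hE : ∀ i, MeasurableSet (E i))
    (hf : ∀ i, ContinuousOn f (E i)) (hinj : ∀ i, InjOn f (E i)) (hσ : Measurable σ) :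
    Measurable (fibreMean m f E σ) :=
  Measurable.iSup fun I => Measurable.iSup fun _ =>
    (Finset.measurable_sum I fun i _ => measurable_pushOn (hE i) (hf i) (hinj i) hσ).const_mul _

/-- The sum of `σ` over at most `m` distinct points of one fibre is at most `m` times the mean.
Distinct points of a fibre lie in distinct pieces. -/
theorem sum_le_mul_fibreMean {m : ℕ} (hm : 0 < m) {E : ℕ → Set (Eucl n)}
    (hinj : ∀ i, InjOn f (E i)) (hσ0 : ∀ x, x ∉ ⋃ i, E i → σ x = 0) {y : Eucl n}
    {x : ℕ → Eucl n} (hx : InjOn x (Finset.range m)) (hxy : ∀ j < m, f (x j) = y) :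
    ∑ j ∈ Finset.range m, σ (x j) ≤ m * fibreMean m f E σ y := by
  classical
  set J := (Finset.range m).filter fun j => x j ∈ ⋃ i, E i with hJ
  have hJmem : ∀ j ∈ J, ∃ i, x j ∈ E i := fun j hj => mem_iUnion.1 (Finset.mem_filter.1 hj).2
  choose! ι hι using hJmem
  have hJm : ∀ j ∈ J, j < m := fun j hj => Finset.mem_range.1 (Finset.mem_filter.1 hj).1
  have hιinj : InjOn ι J := by
    intro j hj k hk hjk
    refine hx (Finset.mem_filter.1 hj).1 (Finset.mem_filter.1 hk).1 ?_
    refine hinj (ι j) (hι j hj) (hjk ▸ hι k hk) ?_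
    rw [hxy j (hJm j hj), hxy k (hJm k hk)]
  have hcard : (J.image ι).card ≤ m :=
    Finset.card_image_le.trans ((Finset.card_filter_le _ _).trans (Finset.card_range m).le)
  calc ∑ j ∈ Finset.range m, σ (x j) = ∑ j ∈ J, σ (x j) := by
        rw [hJ, Finset.sum_filter]
        refine Finset.sum_congr rfl fun j _ => ?_
        split_ifs with h
        · rfl
        · exact hσ0 _ h
    _ ≤ ∑ j ∈ J, pushOn f (E (ι j)) σ y := Finset.sum_le_sum fun j hj => by
        rw [← hxy j (hJm j hj)]; exact le_pushOn (hι j hj)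
    _ = ∑ i ∈ J.image ι, pushOn f (E i) σ y := 
        (Finset.sum_image (f := fun i => pushOn f (E i) σ y) hιinj).symm
    _ = m * ((m : ℝ≥0∞)⁻¹ * ∑ i ∈ J.image ι, pushOn f (E i) σ y) := by
        rw [← mul_assoc, ENNReal.mul_inv_cancel (by exact_mod_cast hm.ne')
          (ENNReal.natCast_ne_top m), one_mul]
    _ ≤ m * fibreMean m f E σ y := by
        gcongr
        exact le_iSup₂_of_le (f := fun (I : Finset ℕ) (_ : I.card ≤ m) =>
          (m : ℝ≥0∞)⁻¹ * ∑ i ∈ I, pushOn f (E i) σ y) (J.image ι) hcard le_rfl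

theorem inv_mul_sum_rpow_le {ι : Type*} {m : ℕ} (hm : 0 < m) {p : ℝ} (hp : 1 ≤ p) (I : Finset ι)
    (hI : I.card ≤ m) (z : ι → ℝ≥0∞) :
    ((m : ℝ≥0∞)⁻¹ * ∑ i ∈ I, z i) ^ p ≤ (m : ℝ≥0∞)⁻¹ * ∑ i ∈ I, z i ^ p := by
  have hm0 : (m : ℝ≥0∞) ≠ 0 := by exact_mod_cast hm.ne'
  have hmt : (m : ℝ≥0∞) ≠ ∞ := ENNReal.natCast_ne_top m
  have hp0 : 0 ≤ p := zero_le_one.trans hp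
  rw [ENNReal.mul_rpow_of_nonneg _ _ hp0]
  calc (m : ℝ≥0∞)⁻¹ ^ p * (∑ i ∈ I, z i) ^ p
      ≤ (m : ℝ≥0∞)⁻¹ ^ p * ((m : ℝ≥0∞) ^ (p - 1) * ∑ i ∈ I, z i ^ p) := by
        gcongr
        refine (ENNReal.rpow_sum_le_const_mul_sum_rpow I z hp).trans ?_
        gcongr
    _ = (m : ℝ≥0∞)⁻¹ * ∑ i ∈ I, z i ^ p := by
        rw [← mul_assoc, ENNReal.inv_rpow, ← ENNReal.rpow_neg, ← ENNReal.rpow_add _ _ hm0 hmt]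
        rw [show -p + (p - 1) = -1 by ring, ENNReal.rpow_neg_one]

theorem fibreMean_rpow_le {m : ℕ} (hm : 0 < m) {p : ℝ} (hp : 1 ≤ p) (E : ℕ → Set (Eucl n))
    (y : Eucl n) :
    fibreMean m f E σ y ^ p ≤ (m : ℝ≥0∞)⁻¹ * ∑' i, pushOn f (E i) σ y ^ p := by
  have hp0 : 0 < p := zero_lt_one.trans_le hp
  rw [← ENNReal.le_rpow_inv_iff hp0]
  refine iSup₂_le fun I hI => ?_
  rw [ENNReal.le_rpow_inv_iff hp0]
  refine (inv_mul_sum_rpow_le hm hp I hI _).trans ?_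
  gcongr
  exact ENNReal.sum_le_tsum I

/-- The change of variables formula, summed over the pieces. -/
theorem lintegral_fibreMean_rpow_le {m : ℕ} (hm : 0 < m) {p : ℝ} (hp : 1 ≤ p)
    {E : ℕ → Set (Eucl n)} (hdisj : Pairwise (Function.onFun Disjoint E))
    (hE : ∀ i, MeasurableSet (E i)) (hd : ∀ i, ∀ x ∈ E i, DifferentiableAt ℝ f x)
    (hinj : ∀ i, InjOn f (E i)) (hσ : Measurable σ) :
    ∫⁻ y, fibreMean m f E σ y ^ p ≤
      (m : ℝ≥0∞)⁻¹ * ∫⁻ x in ⋃ i, E i, ENNReal.ofReal |(fderiv ℝ f x).det| * σ x ^ p := by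
  have hmeas : ∀ i, Measurable fun y => pushOn f (E i) σ y ^ p := fun i =>
    (measurable_pushOn (hE i) (fun x hx => (hd i x hx).continuousAt.continuousWithinAt)
      (hinj i) hσ).pow_const p
  calc ∫⁻ y, fibreMean m f E σ y ^ p
      ≤ ∫⁻ y, (m : ℝ≥0∞)⁻¹ * ∑' i, pushOn f (E i) σ y ^ p :=
        lintegral_mono fun y => fibreMean_rpow_le hm hp E y
    _ = (m : ℝ≥0∞)⁻¹ * ∑' i, ∫⁻ y, pushOn f (E i) σ y ^ p := by
        rw [lintegral_const_mul _ (Measurable.tsum hmeas),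
          lintegral_tsum fun i => (hmeas i).aemeasurable]
    _ = (m : ℝ≥0∞)⁻¹ * ∫⁻ x in ⋃ i, E i, ENNReal.ofReal |(fderiv ℝ f x).det| * σ x ^ p := by
        rw [lintegral_iUnion hE hdisj]
        congr 1
        exact tsum_congr fun i => lintegral_pushOn_rpow (zero_lt_one.trans_le hp) (hE i) (hd i)
          (hinj i)

end Push

/-! ### Modulus and line integrals -/

section Modulus

variable {n : ℕ}

theorem setLIntegral_normalRep_le_lineIntegral {γ : Curve n} {a b : ℝ} (h : γ.IsClosedOn a b)
    (ρ : Eucl n → ℝ≥0∞) :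
    ∫⁻ s in Icc 0 (curveLength γ.toFun a b), ρ (normalRep γ.toFun a b s) ≤ lineIntegral ρ γ := by
  have ha : a ∈ γ.dom := by rw [h.2]; exact left_mem_Icc.2 h.1
  have hb : b ∈ γ.dom := by rw [h.2]; exact right_mem_Icc.2 h.1
  exact le_iSup₂_of_le a ha (le_iSup₂_of_le b hb (le_iSup_of_le h.1 le_rfl))

theorem lineIntegral_mono {ρ ρ' : Eucl n → ℝ≥0∞} (h : ρ ≤ ρ') (γ : Curve n) :
    lineIntegral ρ γ ≤ lineIntegral ρ' γ :=
  iSup₂_mono fun _ _ => iSup₂_mono fun _ _ => iSup_mono fun _ => lintegral_mono fun _ => h _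

theorem modulus_mono {p : ℝ} {Γ Γ' : Set (Curve n)} (h : Γ ⊆ Γ') :
    modulus p Γ ≤ modulus p Γ' :=
  iInf_mono fun _ => iInf_mono' fun hρ => ⟨⟨hρ.1, fun γ hγ => hρ.2 γ (h hγ)⟩, le_rfl⟩

theorem modulus_le {p : ℝ} {Γ : Set (Curve n)} {ρ : Eucl n → ℝ≥0∞} (hρ : Admissible Γ ρ) :
    modulus p Γ ≤ ∫⁻ x, ρ x ^ p :=
  iInf₂_le ρ hρ

/-- Subadditivity of the modulus: the maximum of two admissible functions is admissible for the
union. -/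
theorem modulus_union_le {p : ℝ} (hp : 0 ≤ p) (Γ Γ' : Set (Curve n)) :
    modulus p (Γ ∪ Γ') ≤ modulus p Γ + modulus p Γ' := by
  unfold modulus
  simp only [ENNReal.iInf_add, ENNReal.add_iInf]
  refine le_iInf₂ fun ρ' hρ' => le_iInf₂ fun ρ hρ => ?_
  have hadm : Admissible (Γ ∪ Γ') fun x => max (ρ x) (ρ' x) := by
    refine ⟨hρ.1.max hρ'.1, ?_⟩
    rintro γ (hγ | hγ) hrect
    · exact (hρ.2 γ hγ hrect).trans (lineIntegral_mono (fun x => le_max_left _ _) γ)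
    · exact (hρ'.2 γ hγ hrect).trans (lineIntegral_mono (fun x => le_max_right _ _) γ)
  refine (modulus_le hadm).trans ?_
  rw [← lintegral_add_left (hρ.1.pow_const p)]
  refine lintegral_mono fun x => ?_
  rw [(ENNReal.monotone_rpow_of_nonneg hp).map_max]
  exact max_le le_self_add le_add_self

end Modulus

/-! ### Windings -/

theorem setLIntegral_Icc_eq_sum_translates (G : ℝ → ℝ≥0∞) {h : ℝ} (hh : 0 ≤ h) (m : ℕ) :
    ∫⁻ s in Icc 0 (m * h), G s = ∑ j ∈ Finset.range m, ∫⁻ s in Ioo 0 h, G (s + j * h) := by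
  rw [setLIntegral_congr Ioc_ae_eq_Icc.symm]
  induction m with
  | zero => simp
  | succ k ih =>
    have h1 : (0 : ℝ) ≤ k * h := by positivity
    have h2 : (k : ℝ) * h ≤ ((k + 1 : ℕ) : ℝ) * h := by push_cast; nlinarith
    rw [Finset.sum_range_succ, ← ih, ← Ioc_union_Ioc_eq_Ioc h1 h2,
      lintegral_union measurableSet_Ioc (Ioc_disjoint_Ioc_of_le le_rfl)]
    congr 1
    rw [setLIntegral_congr Ioo_ae_eq_Ioc,
      ← (measurePreserving_add_right volume ((k : ℝ) * h)).setLIntegral_comp_preimage_emb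
        (measurableEmbedding_addRight _) G]
    congr 2
    rw [preimage_add_const_Ioc, sub_self]
    congr 1
    push_cast; ring

/-- If `R` is `h`-periodic on `(0, mh)` and the sum of the `m` translates of `G` is at most `m R`,
then `∫ G ≤ ∫ R` over `[0, mh]`. -/
theorem setLIntegral_le_of_sum_translates_le {G R : ℝ → ℝ≥0∞} {h : ℝ} (hh : 0 ≤ h) (m : ℕ)
    (hR : ∀ s ∈ Ioo 0 h, ∀ j < m, R (s + j * h) = R s)
    (hG : ∀ s ∈ Ioo 0 h, ∑ j ∈ Finset.range m, G (s + j * h) ≤ m * R s) :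
    ∫⁻ s in Icc 0 (m * h), G s ≤ ∫⁻ s in Icc 0 (m * h), R s := by
  rw [setLIntegral_Icc_eq_sum_translates G hh, setLIntegral_Icc_eq_sum_translates R hh]
  -- The inequality `∫ f + ∫ g ≤ ∫ (f + g)` needs no measurability.
  have hsuper : ∀ k : ℕ, ∑ j ∈ Finset.range k, ∫⁻ s in Ioo 0 h, G (s + j * h) ≤
      ∫⁻ s in Ioo 0 h, ∑ j ∈ Finset.range k, G (s + j * h) := by
    intro k
    induction k with
    | zero => simp
    | succ k ih =>
      simp only [Finset.sum_range_succ]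
      exact (add_le_add_left ih _).trans (le_lintegral_add _ _)
  calc ∑ j ∈ Finset.range m, ∫⁻ s in Ioo 0 h, G (s + j * h)
      ≤ ∫⁻ s in Ioo 0 h, ∑ j ∈ Finset.range m, G (s + j * h) := hsuper m
    _ ≤ ∫⁻ s in Ioo 0 h, m * R s := setLIntegral_mono' measurableSet_Ioo hG
    _ = ∑ j ∈ Finset.range m, ∫⁻ s in Ioo 0 h, R (s + j * h) := by
        rw [lintegral_const_mul' _ _ (ENNReal.natCast_ne_top m)]
        rw [Finset.sum_congr rfl fun j hj => setLIntegral_congr_fun measurableSet_Ioo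
          fun s hs => hR s hs j (Finset.mem_range.1 hj)]
        simp

/-! ### The modulus inequality -/

section Winding

variable {n : ℕ}

/-- The density `σ = ρ / l(f')` on the regular set of `f` in `D`, and `0` off it. -/
noncomputable def stretchedDensity (D : Set (Eucl n)) (f : Eucl n → Eucl n)
    (ρ : Eucl n → ℝ≥0∞) : Eucl n → ℝ≥0∞ :=
  (regularSet D f).indicator fun x => ENNReal.ofReal (1 / minStretch (fderiv ℝ f x)) * ρ x

theorem measurable_stretchedDensity (hn : 0 < n) {D : Set (Eucl n)} (hD : IsOpen D)
    (f : Eucl n → Eucl n) {ρ : Eucl n → ℝ≥0∞} (hρ : Measurable ρ) :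
    Measurable (stretchedDensity D f ρ) :=
  ((((continuous_minStretch hn).measurable.comp
    (measurable_fderiv ℝ f)).const_div 1).ennreal_ofReal.mul hρ).indicator
      (measurableSet_regularSet hD f)

theorem abs_det_mul_stretchedDensity_rpow (hn : 0 < n) {D : Set (Eucl n)} {f : Eucl n → Eucl n}
    (ρ : Eucl n → ℝ≥0∞) {p : ℝ} (hp : 0 ≤ p) {x : Eucl n} (hx : x ∈ regularSet D f) :
    ENNReal.ofReal |(fderiv ℝ f x).det| * stretchedDensity D f ρ x ^ p =
      innerDilatation p f x * ρ x ^ p := by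
  have hpos := minStretch_pos hn hx.2.2
  rw [stretchedDensity, indicator_of_mem hx, innerDilatation, if_pos hx.2.2,
    ENNReal.mul_rpow_of_nonneg _ _ hp, ← mul_assoc,
    ENNReal.ofReal_rpow_of_nonneg (by positivity) hp, ← ENNReal.ofReal_mul (abs_nonneg _)]
  congr 2
  rw [Real.div_rpow zero_le_one hpos.le, Real.one_rpow, mul_one_div]

/-- The comparison of line integrals for one curve: if `f` winds `α` `m` times around itself, the
`f`-representation `φ` of `α` is absolutely continuous, and `β = f ∘ α` spends no time in a set `F`
containing the images of the irregular points, then `∫_α ρ |dx| ≤ ∫_β ρ' |dx|` with `ρ'` the mean of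
the `m` largest values of `ρ / l(f')` over the fibres. -/
theorem lineIntegral_le_lineIntegral_fibreMean (hn : 0 < n) {D F : Set (Eucl n)}
    {f : Eucl n → Eucl n} {m : ℕ} (hm : 0 < m) {E : ℕ → Set (Eucl n)}
    (hE : (⋃ i, E i) = regularSet D f) (hinj : ∀ i, InjOn f (E i))
    (hF : f '' (D \ regularSet D f) ⊆ F) {ρ : Eucl n → ℝ≥0∞} (hρ : Measurable ρ)
    {α β : Curve n} (hlift : IsLifting D f α β) {a b : ℝ} (hab : β.IsClosedOn a b)
    (hβ : BoundedVariationOn β.toFun (Icc a b)) (hα : BoundedVariationOn α.toFun (Icc a b))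
    {φ : ℝ → Eucl n} (hφ : AbsolutelyContinuousOnInterval φ 0 (curveLength β.toFun a b))
    (hrep : ∀ t ∈ Icc a b, α.toFun t = φ (lengthFun β.toFun a b t))
    (hperiod : ∀ (t : ℝ) (j : ℕ), 1 ≤ j → j < m → 0 ≤ t →
      t < t + j * (curveLength β.toFun a b / m) →
      t + j * (curveLength β.toFun a b / m) < curveLength β.toFun a b →
      normalRep β.toFun a b (t + j * (curveLength β.toFun a b / m)) = normalRep β.toFun a b t ∧
        φ (t + j * (curveLength β.toFun a b / m)) ≠ φ t)
    (hnull : ∀ᵐ s, s ∈ Icc 0 (curveLength β.toFun a b) → normalRep β.toFun a b s ∉ F) :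
    lineIntegral ρ α ≤ lineIntegral (fibreMean m f E (stretchedDensity D f ρ)) β := by
  have hβc : ContinuousOn β.toFun (Icc a b) := hab.2 ▸ β.continuousOn
  have himg := lengthFun_image hab.1 hβc hβ
  have hlip := normalRep_lipschitzOnWith hab.1 hβc hβ
  have hc0 : 0 ≤ curveLength β.toFun a b := curveLength_nonneg hab.1
  have hline := lineIntegral_le_lintegral_norm_deriv hρ (hlift.2.1.trans hab.2) hα hc0 hφ
    (lengthFun_monotoneOn hβ) (mapsTo_iff_image_subset.2 himg.subset) hrep
  set c := curveLength β.toFun a b with hc_def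
  set ψ := normalRep β.toFun a b with hψ
  set σ := stretchedDensity D f ρ with hσ
  have hpar : ∀ s ∈ Icc 0 c, φ s ∈ D ∧ f (φ s) = ψ s := by
    rw [← himg]
    rintro _ ⟨t, ht, rfl⟩
    rw [hψ, normalRep_lengthFun hβ ht, ← hrep t ht]
    have htd : t ∈ β.dom := hab.2 ▸ ht
    exact ⟨hlift.1 (hlift.2.1 ▸ htd), (hlift.2.2 t htd).symm⟩
  have huIcc : uIcc 0 c = Icc 0 c := uIcc_of_le hc0
  -- The chain rule gives `|φ'| ≤ 1 / l(f'(φ))` at almost every parameter.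
  have hspeed : ∫⁻ s in Icc 0 c, ρ (φ s) * ENNReal.ofReal ‖deriv φ s‖ ≤
      ∫⁻ s in Icc 0 c, σ (φ s) := by
    refine lintegral_mono_ae ((ae_restrict_iff' measurableSet_Icc).2 ?_)
    filter_upwards [hnull, hφ.boundedVariationOn.ae_differentiableAt_of_mem_uIcc,
      Measure.ae_ne volume 0, Measure.ae_ne volume c] with s hsF hsd hs0 hsc hs
    have hsI : s ∈ Ioo 0 c := ⟨hs.1.lt_of_ne' hs0, hs.2.lt_of_ne hsc⟩
    obtain ⟨hsD, hfs⟩ := hpar s hs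
    have hreg : φ s ∈ regularSet D f := by
      by_contra hcon
      exact hsF hs (hfs ▸ hF (mem_image_of_mem f ⟨hsD, hcon⟩))
    have hle := norm_deriv_le_inv_minStretch hn (Icc_mem_nhds hsI.1 hsI.2) hlip
      (fun s hs => (hpar s hs).2) (hsd (huIcc ▸ hs)) hreg.2.1 hreg.2.2
    rw [hσ, stretchedDensity, indicator_of_mem hreg, mul_comm]
    gcongr
  have hm' : (0 : ℝ) < m := by exact_mod_cast hm
  have hmh : (m : ℝ) * (c / m) = c := by field_simp
  have hh : 0 ≤ c / m := by positivity
  have hlt : ∀ s ∈ Ioo 0 (c / m), ∀ j < m, s + j * (c / m) < c := by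
    intro s hs j hj
    have hj1 : (j : ℝ) + 1 ≤ m := by exact_mod_cast hj
    have := mul_le_mul_of_nonneg_right hj1 hh
    rw [hmh] at this
    linarith [hs.2]
  have hψper : ∀ s ∈ Ioo 0 (c / m), ∀ j < m, ψ (s + j * (c / m)) = ψ s := by
    intro s hs j hj
    rcases Nat.eq_zero_or_pos j with rfl | hj0
    · simp
    · have hhpos : 0 < c / m := hs.1.trans hs.2
      exact (hperiod s j hj0 hj hs.1.le (lt_add_of_pos_right _ (by positivity))
        (hlt s hs j hj)).1
  -- The points `φ (s + j h)`, `j < m`, are distinct and lie in the fibre over `ψ s`.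
  have hwind : ∫⁻ s in Icc 0 c, σ (φ s) ≤ ∫⁻ s in Icc 0 c, fibreMean m f E σ (ψ s) := by
    have := setLIntegral_le_of_sum_translates_le (G := fun s => σ (φ s))
      (R := fun s => fibreMean m f E σ (ψ s)) hh m
      (fun s hs j hj => by rw [hψper s hs j hj]) (fun s hs => ?_)
    · rwa [hmh] at this
    have hhpos : 0 < c / m := hs.1.trans hs.2
    have hne : ∀ i j, i < j → j < m → φ (s + j * (c / m)) ≠ φ (s + i * (c / m)) := by
      intro i j hij hj
      have h0 : 0 ≤ s + i * (c / m) := add_nonneg hs.1.le (by positivity)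
      have hsum : s + i * (c / m) + ((j - i : ℕ) : ℝ) * (c / m) = s + j * (c / m) := by
        rw [Nat.cast_sub hij.le]; ring
      have hji : (0 : ℝ) < ((j - i : ℕ) : ℝ) := by exact_mod_cast Nat.sub_pos_of_lt hij
      have := (hperiod (s + i * (c / m)) (j - i) (Nat.sub_pos_of_lt hij)
        ((Nat.sub_le _ _).trans_lt hj) h0 (lt_add_of_pos_right _ (by positivity))
        (hsum ▸ hlt s hs j hj)).2
      rwa [hsum] at this
    refine sum_le_mul_fibreMean hm hinj (fun x hx => ?_) (x := fun j => φ (s + j * (c / m))) ?_ ?_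
    · rw [hE] at hx; exact indicator_of_notMem hx _
    · intro i hi j hj hij
      have hi' := Finset.mem_range.1 hi
      have hj' := Finset.mem_range.1 hj
      rcases lt_trichotomy i j with h | h | h
      · exact absurd hij.symm (hne i j h hj')
      · exact h
      · exact absurd hij (hne j i h hi')
    · intro j hj
      have h0 : 0 ≤ s + j * (c / m) := add_nonneg hs.1.le (by positivity)
      rw [(hpar _ ⟨h0, (hlt s hs j hj).le⟩).2, hψper s hs j hj]
  exact hline.trans (hspeed.trans (hwind.trans (setLIntegral_normalRep_le_lineIntegral hab _)))

end Winding

theorem theorem2 {n : ℕ} (hn : 2 ≤ n) (p : ℝ) (hp : 1 ≤ p)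
    (D : Set (Eucl n)) (hDo : IsOpen D) (hDc : IsConnected D)
    (f : Eucl n → Eucl n) (hf : ContinuousOn f D)
    (hdisc : DiscreteMapping D f)
    (hdiff : ∀ᵐ x ∂(volume.restrict D), DifferentiableAt ℝ f x)
    (hN : LuzinN D f) (hNinv : LuzinNInv D f) (hACP : ACPInv p D f)
    (Γ : Set (Curve n)) (hΓ : ∀ γ ∈ Γ, γ.LiesIn D)
    (m : ℕ) (hm : 0 < m) (hwind : ∀ γ ∈ Γ, WindsAround f m γ)
    (ρ : Eucl n → ℝ≥0∞) (hρ : Admissible Γ ρ) :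
    modulus p (imageFamily D f Γ) ≤
      (1 / (m : ℝ≥0∞)) * ∫⁻ x in D, innerDilatation p f x * ρ x ^ p := by
  have hn0 : 0 < n := by omega
  have hp0 : 0 < p := zero_lt_one.trans_le hp
  obtain ⟨E, hdisj, hEm, hEU, hinj⟩ := exists_injective_partition hDo f
  have hEreg : ∀ i, E i ⊆ regularSet D f := fun i => hEU ▸ subset_iUnion E i
  set σ := stretchedDensity D f ρ with hσ
  have hσm : Measurable σ := measurable_stretchedDensity hn0 hDo f hρ.1
  -- The images of the irregular points lie in a Borel null set `F`.
  obtain ⟨F, hF, hFm, hF0⟩ := exists_measurable_superset_of_null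
    (hN _ sdiff_subset (volume_diff_regularSet hDo hdiff hNinv))
  set R : Eucl n → ℝ≥0∞ := fibreMean m f E σ with hR
  have hRm : Measurable R := measurable_fibreMean m hEm
    (fun i => hf.mono fun x hx => (hEreg i hx).1) hinj hσm
  -- Curves that spend positive time in `F` are taken care of by adding `∞` on `F`.
  set R' : Eucl n → ℝ≥0∞ := R + F.indicator fun _ => ∞ with hR'
  have hR'm : Measurable R' := hRm.add (measurable_const.indicator hFm)
  have hR'ae : ∫⁻ y, R' y ^ p = ∫⁻ y, R y ^ p := by
    refine lintegral_congr_ae ?_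
    filter_upwards [measure_eq_zero_iff_ae_notMem.1 hF0] with y hy
    simp [hR', indicator_of_notMem hy]
  have hintR : ∫⁻ y, R y ^ p ≤ (1 / (m : ℝ≥0∞)) * ∫⁻ x in D, innerDilatation p f x * ρ x ^ p := by
    refine (lintegral_fibreMean_rpow_le hm hp hdisj hEm (fun i x hx => (hEreg i hx).2.1) hinj
      hσm).trans ?_
    rw [one_div, hEU]
    refine mul_le_mul' le_rfl ?_
    rw [setLIntegral_congr_fun (measurableSet_regularSet hDo f) fun x hx =>
      abs_det_mul_stretchedDensity_rpow hn0 ρ hp0.le hx]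
    exact lintegral_mono_set fun x hx => hx.1
  set Γ₀ : Set (Curve n) := {β : Curve n | ∃ a b : ℝ, β.IsClosedOn a b ∧ β.Rectifiable ∧
    ¬ ∀ γ : Curve n, IsLifting D f γ β →
      γ.Rectifiable ∧
      ∃ γs : ℝ → Eucl n, IsFRep f γ.toFun a b γs ∧
        AbsolutelyContinuousOnInterval γs 0 (curveLength β.toFun a b)} with hΓ₀
  have hadm : Admissible (imageFamily D f Γ \ Γ₀) R' := by
    refine ⟨hR'm, ?_⟩
    rintro β ⟨⟨α, hαΓ, hlift⟩, hβ₀⟩ -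
    obtain ⟨a, b, hαab, hfα, αs, hαs, hper⟩ := hwind α hαΓ
    have hab : β.IsClosedOn a b := ⟨hαab.1, hlift.2.1 ▸ hαab.2⟩
    have hEq : EqOn β.toFun (f ∘ α.toFun) (Icc a b) := fun t ht => hlift.2.2 t (hab.2 ▸ ht)
    have hβbv : BoundedVariationOn β.toFun (Icc a b) := by
      unfold BoundedVariationOn; rw [eVariationOn.congr hEq]; exact hfα
    have hβc : ContinuousOn β.toFun (Icc a b) := hab.2 ▸ β.continuousOn
    have hβrect : β.Rectifiable := by unfold Curve.Rectifiable; rw [hab.2]; exact hβbv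
    have hgood : ∀ γ : Curve n, IsLifting D f γ β → γ.Rectifiable ∧
        ∃ γs : ℝ → Eucl n, IsFRep f γ.toFun a b γs ∧
          AbsolutelyContinuousOnInterval γs 0 (curveLength β.toFun a b) := by
      by_contra hcon
      exact hβ₀ ⟨a, b, hab, hβrect, hcon⟩
    obtain ⟨hαrect, φ, hφrep, hφac⟩ := hgood α hlift
    have hαbv : BoundedVariationOn α.toFun (Icc a b) := hαab.2 ▸ hαrect
    have himg := lengthFun_image hab.1 hβc hβbv
    have hlip := normalRep_lipschitzOnWith hab.1 hβc hβbv
    have hrep : ∀ t ∈ Icc a b, α.toFun t = φ (lengthFun β.toFun a b t) := fun t ht => by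
      rw [lengthFun_congr hEq]; exact hφrep t ht
    -- The `f`-representation is unique on `[0, l(β)]`.
    have hφαs : ∀ s ∈ Icc 0 (curveLength β.toFun a b), αs s = φ s := by
      rw [← himg]
      rintro _ ⟨t, ht, rfl⟩
      rw [← hrep t ht, lengthFun_congr hEq]
      exact (hαs t ht).symm
    by_cases hnull : ∀ᵐ s, s ∈ Icc 0 (curveLength β.toFun a b) → normalRep β.toFun a b s ∉ F
    · refine (hρ.2 α hαΓ hαrect.locallyBoundedVariationOn).trans ?_
      refine (lineIntegral_le_lineIntegral_fibreMean hn0 hm hEU hinj hF hρ.1 hlift hab hβbv hαbv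
        hφac hrep ?_ hnull).trans (lineIntegral_mono (fun y => le_self_add) β)
      intro t j hj hjm ht htj htc
      have hmem : t ∈ Icc 0 (curveLength β.toFun a b) := ⟨ht, (htj.trans htc).le⟩
      have hmem' : t + j * (curveLength β.toFun a b / m) ∈ Icc 0 (curveLength β.toFun a b) :=
        ⟨(ht.trans_lt htj).le, htc.le⟩
      have hcurve := curveLength_congr hEq
      have hnorm := normalRep_congr hab.1 hβc hβbv hEq
      rw [← hφαs _ hmem, ← hφαs _ hmem', hnorm hmem, hnorm hmem']
      rw [hcurve] at htj htc ⊢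
      exact hper t j hj hjm ht htj htc
    · refine le_trans ?_ (setLIntegral_normalRep_le_lineIntegral hab R')
      set c := curveLength β.toFun a b
      have hm1 : AEMeasurable (fun s => R' (normalRep β.toFun a b s))
          (volume.restrict (Icc 0 c)) :=
        hR'm.comp_aemeasurable (hlip.continuousOn.aemeasurable measurableSet_Icc)
      rw [lintegral_eq_top_of_measure_eq_top_ne_zero hm1]
      · exact le_top
      · intro h0
        refine hnull ?_
        have h1 := measure_eq_zero_iff_ae_notMem.1 h0
        rw [ae_restrict_iff' measurableSet_Icc] at h1
        filter_upwards [h1] with s hs hsI hsF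
        exact hs hsI (by simp [hR', indicator_of_mem hsF])
  have hsub : imageFamily D f Γ ⊆ (imageFamily D f Γ \ Γ₀) ∪ Γ₀ := fun β hβ => by
    by_cases h : β ∈ Γ₀
    · exact Or.inr h
    · exact Or.inl ⟨hβ, h⟩
  calc modulus p (imageFamily D f Γ)
      ≤ modulus p (imageFamily D f Γ \ Γ₀) + modulus p Γ₀ :=
        (modulus_mono hsub).trans (modulus_union_le hp0.le _ _)
    _ = modulus p (imageFamily D f Γ \ Γ₀) := by rw [show modulus p Γ₀ = 0 from hACP, add_zero]
    _ ≤ ∫⁻ y, R' y ^ p := modulus_le hadm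
    _ ≤ (1 / (m : ℝ≥0∞)) * ∫⁻ x in D, innerDilatation p f x * ρ x ^ p := hR'ae ▸ hintR
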